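/- Theorem 2.4. Let $n,N\in\mathbb N$ and $\mathcal H=[L^2(\mathbb R^n)]^N$. Let $$\nabla=(\partial_1,\dots,\partial_n)^{\top}:[W^{1,2}(\mathbb R^n)]^N\to\mathcal H^{\,n}$$ be the (closed) gradient, where the $\partial_j$ are weak partial derivatives. Let $F_1,\dots,F_n\in\mathcal B(L^2(\mathbb R^n))^{N\times N}=\mathcal B(\mathcal H)$ be bounded operators on $\mathcal H$ (for example, operators of multiplication by $N\times N$ matrices with entries in $L^\infty(\mathbb R^n)$), with adjoints $F_j^*$. Let $\mathcal D\subseteq\mathcal H$ be a linear subspace that is a core for $\nabla$ (that is, $\mathcal D\subseteq[W^{1,2}(\mathbb R^n)]^N$ and the closure of $\nabla|_{\mathcal D}$ is $\nabla$), and assume that $$F_j(\mathcal D)\subseteq\mathcal D,\qquad F_j^*(\mathcal D)\subseteq\mathcal D,\qquad 1\le j\le n,$$ and that the commutators $$[-i\partial_k,F_j],\ [-i\partial_k,F_j^*]:\mathcal D\to\mathcal H,\qquad 1\le j,k\le n,$$ extend to bounded operators on $\mathcal H$. Then the operator $$L=-i\sum_{j=1}^nF_j\partial_j-i\sum_{j=1}^n\partial_jF_j^*:\mathcal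 D\to\mathcal H$$ is essentially self-adjoint; that is, $L$ is densely defined and symmetric, and its closure $\overline L$ is self-adjoint. -/

import Mathlib

open MeasureTheory
open scoped LineDeriv SchwartzMap

noncomputable section

namespace FirstOrder

/-- The Hilbert space `L²(ℝⁿ)^N`, realized as the space of square integrable `ℂ^N`-valued
functions on `ℝⁿ` (modulo equality almost everywhere). -/
abbrev L2 (n N : ℕ) : Type :=
  Lp (EuclideanSpace ℂ (Fin N)) 2 (volume : Measure (EuclideanSpace ℝ (Fin n)))

/-- `g` is the weak (distributional) partial derivative `∂_j f`, for `f, g ∈ L²(ℝⁿ)^N`. -/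
def IsWeakDeriv {n N : ℕ} (j : Fin n) (f g : L2 n N) : Prop :=
  ∂_{(EuclideanSpace.single j (1 : ℝ) : EuclideanSpace ℝ (Fin n))}
      (f : 𝓢'(EuclideanSpace ℝ (Fin n), EuclideanSpace ℂ (Fin N))) =
    (g : 𝓢'(EuclideanSpace ℝ (Fin n), EuclideanSpace ℂ (Fin N)))

/-- The graph of the gradient: all `(f, (g_1, …, g_n))` with `∂_j f = g_j` weakly. -/
def gradGraph (n N : ℕ) : Submodule ℂ (L2 n N × PiLp 2 (fun _ : Fin n => L2 n N)) where
  carrier := {p | ∀ j, IsWeakDeriv j p.1 (p.2 j)}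
  add_mem' {p q} hp hq j := by
    have h1 := hp j
    have h2 := hq j
    simp only [IsWeakDeriv, ← Lp.toTemperedDistributionCLM_apply] at h1 h2 ⊢
    simp only [Prod.fst_add, Prod.snd_add, PiLp.add_apply, map_add,
      LineDeriv.lineDerivOp_add, h1, h2]
  zero_mem' j := by
    simp only [IsWeakDeriv, ← Lp.toTemperedDistributionCLM_apply]
    simp only [Prod.fst_zero, Prod.snd_zero, PiLp.zero_apply, map_zero,
      LineDeriv.lineDerivOp_zero]
  smul_mem' c p hp j := by
    have h1 := hp j
    simp only [IsWeakDeriv, ← Lp.toTemperedDistributionCLM_apply] at h1 ⊢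
    simp only [Prod.smul_fst, Prod.smul_snd, PiLp.smul_apply, map_smul,
      LineDeriv.lineDerivOp_smul, h1]

/-- The gradient `∇ = (∂_1, …, ∂_n)` as an unbounded operator from `L²(ℝⁿ)^N` to the `n`-fold
Hilbert space direct sum of `L²(ℝⁿ)^N`. Its domain consists of all `f` with weak derivatives
`∂_1 f, …, ∂_n f` in `L²(ℝⁿ)^N`, that is, it is the Sobolev space `W^{1,2}(ℝⁿ)^N`. -/
def grad (n N : ℕ) : L2 n N →ₗ.[ℂ] PiLp 2 (fun _ : Fin n => L2 n N) :=
  (gradGraph n N).toLinearPMap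

/-- Weak derivatives are unique, so the graph of `grad` really is `gradGraph`. -/
theorem graph_grad (n N : ℕ) : (grad n N).graph = gradGraph n N := by
  refine Submodule.toLinearPMap_graph_eq _ ?_
  rintro ⟨f, g⟩ h hf
  obtain rfl : f = 0 := hf
  ext1 j
  have hj := h j
  simp only [IsWeakDeriv, ← Lp.toTemperedDistributionCLM_apply, map_zero,
    LineDeriv.lineDerivOp_zero] at hj
  have : g j ∈ (Lp.toTemperedDistributionCLM (EuclideanSpace ℂ (Fin N))
      (volume : Measure (EuclideanSpace ℝ (Fin n))) 2).ker := hj.symm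
  rw [Lp.ker_toTemperedDistributionCLM_eq_bot] at this
  simpa using this

/-- The partial derivative `∂_j : W^{1,2}(ℝⁿ)^N → L²(ℝⁿ)^N`. -/
def partialD {n : ℕ} (N : ℕ) (j : Fin n) : (grad n N).domain →ₗ[ℂ] L2 n N where
  toFun f := grad n N f j
  map_add' f g := by simp [LinearPMap.map_add]
  map_smul' c f := by simp [LinearPMap.map_smul]

/-- The commutator `[-i ∂_k, F] f = -i ∂_k (F f) - F (-i ∂_k f)` for `f` in a subspace `D` of
`W^{1,2}(ℝⁿ)^N` that is mapped into itself by `F`. -/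
def partialComm {n N : ℕ} (k : Fin n) (F : L2 n N →L[ℂ] L2 n N) {D : Submodule ℂ (L2 n N)}
    (hD : D ≤ (grad n N).domain) (hF : ∀ f ∈ D, F f ∈ D) (f : D) : L2 n N :=
  -Complex.I • partialD N k ⟨F f, hD (hF f f.2)⟩ - F (-Complex.I • partialD N k ⟨f, hD f.2⟩)

/-- The operator `L = -i ∑_j F_j ∂_j - i ∑_j ∂_j F_j^*` with domain `D`. -/
def firstOrderOp {n N : ℕ} (F : Fin n → L2 n N →L[ℂ] L2 n N) (D : Submodule ℂ (L2 n N))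
    (hD : D ≤ (grad n N).domain)
    (hF : ∀ j, ∀ f ∈ D, ContinuousLinearMap.adjoint (F j) f ∈ D) :
    L2 n N →ₗ.[ℂ] L2 n N where
  domain := D
  toFun :=
    { toFun := fun f =>
        -Complex.I • ∑ j, F j (partialD N j ⟨f, hD f.2⟩) -
          Complex.I • ∑ j, partialD N j
            ⟨ContinuousLinearMap.adjoint (F j) f, hD (hF j f f.2)⟩
      map_add' := fun f g => by
        have h1 (j : Fin n) : partialD N j ⟨(f + g : D), hD (f + g).2⟩ =
            partialD N j ⟨f, hD f.2⟩ + partialD N j ⟨g, hD g.2⟩ := by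
          rw [← map_add]; rfl
        have h2 (j : Fin n) : partialD N j
              ⟨ContinuousLinearMap.adjoint (F j) (f + g : D), hD (hF j _ (f + g).2)⟩ =
            partialD N j ⟨ContinuousLinearMap.adjoint (F j) f, hD (hF j f f.2)⟩ +
            partialD N j ⟨ContinuousLinearMap.adjoint (F j) g, hD (hF j g g.2)⟩ := by
          rw [← map_add]
          congr 1
          exact Subtype.ext (map_add _ _ _)
        simp only [h1, h2, map_add, Finset.sum_add_distrib, smul_add]
        abel
      map_smul' := fun c f => by
        have h1 (j : Fin n) : partialD N j ⟨(c • f : D), hD (c • f).2⟩ =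
            c • partialD N j ⟨f, hD f.2⟩ := by
          rw [← map_smul]; rfl
        have h2 (j : Fin n) : partialD N j
              ⟨ContinuousLinearMap.adjoint (F j) (c • f : D), hD (hF j _ (c • f).2)⟩ =
            c • partialD N j ⟨ContinuousLinearMap.adjoint (F j) f, hD (hF j f f.2)⟩ := by
          rw [← map_smul]
          congr 1
          exact Subtype.ext (map_smul _ _ _)
        simp only [h1, h2, map_smul, ← Finset.smul_sum, RingHom.id_apply, smul_sub,
          smul_comm c] }

/-- An unbounded operator in a Hilbert space is essentially self-adjoint if it is densely defined
and symmetric and its closure is self-adjoint. -/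
def IsEssentiallySelfAdjoint {H : Type*} [NormedAddCommGroup H] [InnerProductSpace ℂ H]
    [CompleteSpace H] (T : H →ₗ.[ℂ] H) : Prop :=
  Dense (T.domain : Set H) ∧ T.IsFormalAdjoint T ∧ IsSelfAdjoint T.closure

end FirstOrder

end

/-!
Write `P_k = -i ∂_k` on `W = W^{1,2}(ℝⁿ)^N`. Since `D` is a core for the gradient and the gradient
is closed, each `F_j` and `F_j^*` maps `W` into itself, with the commutators with `P_k` still
bounded there (`exists_mem_domain_momentum_eq`). Hence the operator extends from `D` to the
symmetric operator `∑_j G_j P_j + B` on `W`, where `G_j = F_j + F_j^*` and `B = ∑_j [P_j, F_j^*]` is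
bounded, and a pair in the graph of the adjoint of the operator on `D` is a weak solution tested
against all of `W`.

By `LinearPMap.isSelfAdjoint_closure`, a densely defined symmetric operator with symmetric adjoint
is essentially self-adjoint. Symmetry of the adjoint is proved by regularizing with the resolvents
`T = (1 + ε ∑_k P_k²)⁻¹`, which are Fourier multipliers (`exists_isLaplaceResolvent`). The point is
that, with `C_k = [P_k, G]` and `Q_k = P_k T`,
`[T, G] = -ε ∑_k (T C_k Q_k + Q_k C_k T)`
involves only single commutators, so that `[T, G] P_j` is bounded uniformly in `ε`
(`IsLaplaceResolvent.norm_commutator_le`). So if `u'` lies in the domain of the adjoint, then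
`y_ε = L T u'` stays bounded; testing against `W` shows that `y_ε` converges weakly to the adjoint
applied to `u'`, and the symmetry follows in the limit `ε → 0` (`inner_eq_of_weak_solutions`).
-/

open Filter Topology
open scoped ContDiff InnerProductSpace LinearPMap FourierTransform ENNReal

/-! ### Density arguments -/

section Abstract

variable {H : Type*} [NormedAddCommGroup H] [InnerProductSpace ℂ H]

/-- Pointwise convergence on a dense set extends to the whole space for maps with a common
Lipschitz constant. -/
theorem tendsto_of_dense_of_norm_sub_le {α H X : Type*} [NormedAddCommGroup H]
    [NormedAddCommGroup X] {l : Filter α}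
    {A : α → H → X} {A₀ : H → X} {s : Set H} (hs : Dense s) (K : ℝ)
    (hA : ∀ᶠ a in l, ∀ x y, ‖A a x - A a y‖ ≤ K * ‖x - y‖) (hA₀ : Continuous A₀)
    (h : ∀ x ∈ s, Tendsto (fun a => A a x) l (𝓝 (A₀ x))) (x : H) :
    Tendsto (fun a => A a x) l (𝓝 (A₀ x)) := by
  rw [Metric.tendsto_nhds]
  intro δ hδ
  have h1 : ∀ᶠ y in 𝓝 x, K * ‖x - y‖ < δ / 3 := by
    have : Tendsto (fun y => K * ‖x - y‖) (𝓝 x) (𝓝 (K * ‖x - x‖)) :=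
      Continuous.tendsto (by fun_prop) x
    rw [sub_self, norm_zero, mul_zero] at this
    exact this.eventually_lt_const (by positivity)
  have h2 : ∀ᶠ y in 𝓝 x, dist (A₀ y) (A₀ x) < δ / 3 :=
    Metric.tendsto_nhds.1 hA₀.continuousAt _ (by positivity)
  obtain ⟨y, ⟨hy1, hy2⟩, hys⟩ := mem_closure_iff_nhds.1 (hs x) _ (h1.and h2)
  filter_upwards [hA, Metric.tendsto_nhds.1 (h y hys) (δ / 3) (by positivity)] with a ha1 ha2
  have h3 : dist (A a x) (A a y) < δ / 3 := by
    rw [dist_eq_norm]; exact (ha1 x y).trans_lt hy1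
  linarith [dist_triangle4 (A a x) (A a y) (A₀ y) (A₀ x)]

theorem norm_le_of_dense_of_norm_inner_le {s : Set H} (hs : Dense s) {y : H} {K : ℝ} (hK : 0 ≤ K)
    (h : ∀ w ∈ s, ‖⟪w, y⟫_ℂ‖ ≤ K * ‖w‖) : ‖y‖ ≤ K := by
  have h1 : ‖⟪y, y⟫_ℂ‖ ≤ K * ‖y‖ := by
    have hc : IsClosed {w : H | ‖⟪w, y⟫_ℂ‖ ≤ K * ‖w‖} :=
      isClosed_le (by fun_prop) (by fun_prop)
    exact hc.closure_subset_iff.2 h (hs y)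
  rcases eq_or_ne y 0 with rfl | hy
  · simpa using hK
  · have : 0 < ‖y‖ := norm_pos_iff.2 hy
    rw [inner_self_eq_norm_sq_to_K] at h1
    simp only [Complex.coe_algebraMap, norm_pow, Complex.norm_real, norm_norm] at h1
    nlinarith

/-! ### A criterion for essential self-adjointness -/

section Criterion

variable [CompleteSpace H]

/-- If the adjoint of a densely defined symmetric operator is symmetric, then it is contained in
the closure: an element `(x, L† x)` of its graph orthogonal to the graph of `L` satisfies
`L† (L† x) = -x`, so that `‖L† x‖² = -‖x‖²`. -/
theorem LinearPMap.adjoint_le_closure {L : H →ₗ.[ℂ] H} (hd : Dense (L.domain : Set H))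
    (hL : L.IsFormalAdjoint L) (hadj : L†.IsFormalAdjoint L†) : L† ≤ L.closure := by
  have hle : L ≤ L† := hL.le_adjoint hd
  have hcl : L†.IsClosed := L.adjoint_isClosed hd
  have hc : L.IsClosable := hcl.isClosable.leIsClosable hle
  refine LinearPMap.le_of_le_graph ?_
  rw [← hc.graph_closure_eq_closure_graph]
  intro p hp
  -- The orthogonal decomposition takes place in the `L²` product, where `H × H` is a Hilbert space.
  let K : Submodule ℂ (WithLp 2 (H × H)) :=
    L.graph.topologicalClosure.comap (WithLp.linearEquiv 2 ℂ (H × H)).toLinearMap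
  have hK : _root_.IsClosed (K : Set (WithLp 2 (H × H))) :=
    L.graph.isClosed_topologicalClosure.preimage (WithLp.prod_continuous_ofLp 2 H H)
  have : CompleteSpace K := hK.completeSpace_coe
  obtain ⟨a, ha, b, hb, hab⟩ := K.exists_add_mem_mem_orthogonal (WithLp.toLp 2 p)
  have ha' : a.ofLp ∈ L.graph.topologicalClosure := ha
  have haL : a.ofLp ∈ L†.graph :=
    Submodule.topologicalClosure_minimal _ (LinearPMap.le_graph_of_le hle) hcl ha'
  have hbL : b.ofLp ∈ L†.graph := by
    have : b.ofLp = p - a.ofLp := by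
      have := congrArg WithLp.ofLp hab
      simp only [WithLp.ofLp_add] at this
      rw [this]; abel
    rw [this]; exact sub_mem hp haL
  obtain ⟨x, hx1, hx2⟩ := (LinearPMap.mem_graph_iff _).1 hbL
  have horth : ∀ w : L.domain, ⟪-(x : H), (w : H)⟫_ℂ = ⟪L† x, L w⟫_ℂ := by
    intro w
    have hw : WithLp.toLp 2 ((w : H), L w) ∈ K :=
      L.graph.le_topologicalClosure (L.mem_graph w)
    have := Submodule.inner_left_of_mem_orthogonal hw hb
    rw [WithLp.prod_inner_apply] at this
    rw [hx1, hx2, inner_neg_left]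
    exact neg_eq_of_add_eq_zero_right this
  have hmem : L† x ∈ L†.domain := LinearPMap.mem_adjoint_domain_of_exists _ ⟨_, horth⟩
  have hval : L† ⟨L† x, hmem⟩ = -(x : H) := LinearPMap.adjoint_apply_eq hd _ horth
  have hs := hadj x ⟨L† x, hmem⟩
  rw [hval, inner_neg_right] at hs
  have hx0 : (x : H) = 0 := by
    have h1 := congrArg Complex.re hs
    simp only [Complex.neg_re] at h1
    have h2 : 0 ≤ (⟪L† x, L† x⟫_ℂ).re := inner_self_nonneg (𝕜 := ℂ)
    have h3 : 0 ≤ (⟪(x : H), (x : H)⟫_ℂ).re := inner_self_nonneg (𝕜 := ℂ)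
    have h4 : (⟪(x : H), (x : H)⟫_ℂ).re = 0 := by linarith
    exact inner_self_eq_zero.1 (Complex.ext h4 (inner_self_im (𝕜 := ℂ) _))
  have hx0' : x = 0 := Subtype.ext hx0
  have hb0 : b.ofLp = 0 := by
    refine Prod.ext ?_ ?_
    · rw [← hx1, hx0]; rfl
    · rw [← hx2, hx0', LinearPMap.map_zero]; rfl
  have : p = a.ofLp := by
    have := congrArg WithLp.ofLp hab
    simpa [hb0] using this
  rw [this]; exact ha'

theorem LinearPMap.isSelfAdjoint_closure {L : H →ₗ.[ℂ] H} (hd : Dense (L.domain : Set H))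
    (hL : L.IsFormalAdjoint L) (hadj : L†.IsFormalAdjoint L†) : IsSelfAdjoint L.closure := by
  have hle : L ≤ L† := hL.le_adjoint hd
  have hcl : L†.IsClosed := L.adjoint_isClosed hd
  have hc : L.IsClosable := hcl.isClosable.leIsClosable hle
  have heq : L.closure = L† := by
    refine le_antisymm ?_ (LinearPMap.adjoint_le_closure hd hL hadj)
    refine LinearPMap.le_of_le_graph ?_
    rw [← hc.graph_closure_eq_closure_graph]
    exact Submodule.topologicalClosure_minimal _ (LinearPMap.le_graph_of_le hle) hcl
  have hd' : Dense (L†.domain : Set H) := hd.mono hle.1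
  rw [LinearPMap.isSelfAdjoint_def, heq]
  refine le_antisymm ?_ (hadj.le_adjoint hd')
  refine LinearPMap.IsFormalAdjoint.le_adjoint hd fun x y => ?_
  rw [hle.2 (y := ⟨x, hle.1 x.2⟩) rfl]
  exact (L†.adjoint_isFormalAdjoint hd').symm _ _

end Criterion

end Abstract

/-! ### Resolvents and commutators -/

section Resolvent

variable {H : Type*} [NormedAddCommGroup H] [InnerProductSpace ℂ H]
variable {ι : Type*} [Fintype ι] {W : Submodule ℂ H}

/-- `T` behaves as the resolvent `(1 + ε ∑ k, P k ^ 2)⁻¹` of commuting symmetric operators `P k`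
with common domain `W`, and `Q k` as `P k ∘ T`. The range of `T` is in the domain of every product
`P j P k`, which is expressed by `apply_mem` and `mem'`; the identity `(1 + ε ∑ k, P k ^ 2) T = 1` is
`resolve`. The bounds are those given by the spectral theorem; the last one bounds the operator
`ε P k T P j`. -/
structure IsLaplaceResolvent (P : ι → W →ₗ[ℂ] H) (ε : ℝ) (T : H →ₗ[ℂ] H)
    (Q : ι → H →ₗ[ℂ] H) : Prop where
  mem : ∀ h, T h ∈ W
  apply_mem : ∀ k h, P k ⟨T h, mem h⟩ = Q k h
  mem' : ∀ k h, Q k h ∈ W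
  resolve : ∀ h, T h + (ε : ℂ) • ∑ k, P k ⟨Q k h, mem' k h⟩ = h
  comm : ∀ k (f : W), T (P k f) = Q k f
  symm : ∀ f g, ⟪T f, g⟫_ℂ = ⟪f, T g⟫_ℂ
  norm_le : ∀ h, ‖T h‖ ≤ ‖h‖
  norm_le' : ∀ k h, √ε * ‖Q k h‖ ≤ ‖h‖
  norm_le'' : ∀ j k (f : W), ε * ‖Q k (P j f)‖ ≤ ‖(f : H)‖

namespace IsLaplaceResolvent

variable {P : ι → W →ₗ[ℂ] H} {ε : ℝ} {T : H →ₗ[ℂ] H} {Q : ι → H →ₗ[ℂ] H}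

theorem apply_Q (hT : IsLaplaceResolvent P ε T Q) (k : ι) (f : W) :
    P k ⟨Q k f, hT.mem' k f⟩ = Q k (P k f) := by
  refine Eq.trans ?_ (hT.apply_mem k (P k f))
  exact congrArg (P k) (Subtype.ext (hT.comm k f).symm)

/-- The resolvent identity with the factors in the other order, `T (1 + ε ∑ k, P k ^ 2) = 1`, in the
form that makes sense on `W`. -/
theorem resolve' (hT : IsLaplaceResolvent P ε T Q) (f : W) :
    T f + (ε : ℂ) • ∑ k, Q k (P k f) = f := by
  simpa only [hT.apply_Q] using hT.resolve f

/-- The commutator of the resolvent with `G` involves only the commutators `C k = [P k, G]`,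
each surrounded by one `T` and one `Q k`. -/
theorem commutator (hT : IsLaplaceResolvent P ε T Q) {G : H →ₗ[ℂ] H} {C : ι → H →ₗ[ℂ] H}
    (hG : ∀ f ∈ W, G f ∈ W) (hC : ∀ k (f : W), P k ⟨G f, hG f f.2⟩ = G (P k f) + C k f) (h : H) :
    T (G h) - G (T h) = -((ε : ℂ) • ∑ k, (T (C k (Q k h)) + Q k (C k (T h)))) := by
  -- Expand `h` in `T (G h)`, then `G (T h)`; the terms `T G T h` and `Q k G Q k h` cancel.
  have h1 : T (G h) = T (G (T h)) +
      (ε : ℂ) • ∑ k, (Q k (G (Q k h)) - T (C k (Q k h))) := by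
    conv_lhs => rw [← hT.resolve h]
    simp only [map_add, map_smul, map_sum]
    congr 2
    refine Finset.sum_congr rfl fun k _ => ?_
    have h2 : G (P k ⟨Q k h, hT.mem' k h⟩) =
        P k ⟨G (Q k h), hG _ (hT.mem' k h)⟩ - C k (Q k h) := by
      rw [hC k ⟨Q k h, hT.mem' k h⟩]; abel
    rw [h2, map_sub, hT.comm]
  have h3 : G (T h) = T (G (T h)) +
      (ε : ℂ) • ∑ k, (Q k (G (Q k h)) + Q k (C k (T h))) := by
    refine (hT.resolve' ⟨G (T h), hG _ (hT.mem h)⟩).symm.trans ?_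
    congr 2
    refine Finset.sum_congr rfl fun k _ => ?_
    rw [hC k ⟨T h, hT.mem h⟩, hT.apply_mem, map_add]
  rw [h1]
  nth_rw 2 [h3]
  rw [add_sub_add_left_eq_sub, ← smul_sub, ← Finset.sum_sub_distrib, ← smul_neg,
    ← Finset.sum_neg_distrib]
  congr 2
  ext k
  abel

/-- The operators `[T, G] P j` are bounded uniformly in `ε`: the factor `ε` compensates the two
factors among the `P k`. -/
theorem norm_commutator_le (hT : IsLaplaceResolvent P ε T Q) (hε : 0 ≤ ε) {G : H →L[ℂ] H}
    {C : ι → H →L[ℂ] H} (hG : ∀ f ∈ W, G f ∈ W)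
    (hC : ∀ k (f : W), P k ⟨G f, hG f f.2⟩ = G (P k f) + C k f) (j : ι) (f : W) :
    ‖T (G (P j f)) - G (T (P j f))‖ ≤ (2 * ∑ k, ‖C k‖) * ‖(f : H)‖ := by
  have h1 : T (G (P j f)) - G (T (P j f)) =
      -((ε : ℂ) • ∑ k, (T (C k (Q k (P j f))) + Q k (C k (T (P j f))))) :=
    hT.commutator (G := G.toLinearMap) (C := fun k => (C k).toLinearMap) hG hC (P j f)
  rw [h1, norm_neg, norm_smul, Complex.norm_real, Real.norm_of_nonneg hε, mul_assoc,
    Finset.sum_mul]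
  calc ε * ‖∑ k, (T (C k (Q k (P j f))) + Q k (C k (T (P j f))))‖
      ≤ ε * ∑ k, ‖T (C k (Q k (P j f))) + Q k (C k (T (P j f)))‖ := by
        gcongr; exact norm_sum_le _ _
    _ = ∑ k, ε * ‖T (C k (Q k (P j f))) + Q k (C k (T (P j f)))‖ := Finset.mul_sum _ _ _
    _ ≤ ∑ k, 2 * (‖C k‖ * ‖(f : H)‖) := by
        refine Finset.sum_le_sum fun k _ => ?_
        have ha : ε * ‖T (C k (Q k (P j f)))‖ ≤ ‖C k‖ * ‖(f : H)‖ := by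
          calc ε * ‖T (C k (Q k (P j f)))‖ ≤ ε * (‖C k‖ * ‖Q k (P j f)‖) := by
                gcongr; exact (hT.norm_le _).trans ((C k).le_opNorm _)
            _ = ‖C k‖ * (ε * ‖Q k (P j f)‖) := by ring
            _ ≤ ‖C k‖ * ‖(f : H)‖ := by gcongr; exact hT.norm_le'' _ _ _
        have hb : ε * ‖Q k (C k (T (P j f)))‖ ≤ ‖C k‖ * ‖(f : H)‖ := by
          rw [hT.comm]
          calc ε * ‖Q k (C k (Q j f))‖ = √ε * (√ε * ‖Q k (C k (Q j f))‖) := by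
                rw [← mul_assoc, Real.mul_self_sqrt hε]
            _ ≤ √ε * (‖C k‖ * ‖Q j f‖) := by
                exact mul_le_mul_of_nonneg_left
                  ((hT.norm_le' _ _).trans ((C k).le_opNorm _)) (Real.sqrt_nonneg _)
            _ = ‖C k‖ * (√ε * ‖Q j f‖) := by ring
            _ ≤ ‖C k‖ * ‖(f : H)‖ := by gcongr; exact hT.norm_le' _ _
        calc _ ≤ ε * (‖T (C k (Q k (P j f)))‖ + ‖Q k (C k (T (P j f)))‖) := by
              gcongr; exact norm_add_le _ _
          _ ≤ _ := by linarith
    _ = 2 * ∑ k, ‖C k‖ * ‖(f : H)‖ := by rw [Finset.mul_sum]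

/-- The domain is dense: a vector orthogonal to it is annihilated by the symmetric operator `T`. -/
theorem dense [CompleteSpace H] (hT : IsLaplaceResolvent P ε T Q) : Dense (W : Set H) := by
  rw [Submodule.dense_iff_topologicalClosure_eq_top, Submodule.topologicalClosure_eq_top_iff,
    Submodule.eq_bot_iff]
  intro h hh
  have h0 : T h = 0 := by
    refine ext_inner_left ℂ fun g => ?_
    rw [← hT.symm, inner_zero_right]
    exact Submodule.inner_right_of_mem_orthogonal (hT.mem g) hh
  have hQ : ∀ k, Q k h = 0 := fun k => by
    rw [← hT.apply_mem, ← map_zero (P k)]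
    exact congrArg (P k) (Subtype.ext h0)
  rw [← hT.resolve h, h0, zero_add, Finset.sum_eq_zero, smul_zero]
  intro k _
  rw [← map_zero (P k)]
  exact congrArg (P k) (Subtype.ext (hQ k))

theorem tendsto [CompleteSpace H] {T : ℝ → H →ₗ[ℂ] H} {Q : ℝ → ι → H →ₗ[ℂ] H}
    (hT : ∀ ε > 0, IsLaplaceResolvent P ε (T ε) (Q ε)) (h : H) :
    Tendsto (fun ε => T ε h) (𝓝[>] 0) (𝓝 h) := by
  refine tendsto_of_dense_of_norm_sub_le (A₀ := id) (hT 1 one_pos).dense 1 ?_ continuous_id ?_ h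
  · filter_upwards [self_mem_nhdsWithin] with ε hε x y
    rw [one_mul, ← map_sub]
    exact (hT ε hε).norm_le _
  · intro f hf
    rw [tendsto_iff_norm_sub_tendsto_zero]
    have hlim : Tendsto (fun ε : ℝ => √ε * ∑ k, ‖P k ⟨f, hf⟩‖) (𝓝[>] 0) (𝓝 0) := by
      have : Continuous fun ε : ℝ => √ε * ∑ k, ‖P k ⟨f, hf⟩‖ := by fun_prop
      simpa using (this.tendsto 0).mono_left nhdsWithin_le_nhds
    refine squeeze_zero' (Eventually.of_forall fun _ => norm_nonneg _) ?_ hlim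
    filter_upwards [self_mem_nhdsWithin] with ε hε
    have hε' : (0 : ℝ) ≤ ε := le_of_lt hε
    have h1 : T ε f + (ε : ℂ) • ∑ k, Q ε k (P k ⟨f, hf⟩) = f := (hT ε hε).resolve' ⟨f, hf⟩
    have h2 : T ε f - id f = -((ε : ℂ) • ∑ k, Q ε k (P k ⟨f, hf⟩)) := by
      rw [id, eq_neg_iff_add_eq_zero, sub_add_eq_add_sub, h1, sub_self]
    rw [h2, norm_neg, norm_smul, Complex.norm_real, Real.norm_of_nonneg hε', Finset.mul_sum]
    calc ε * ‖∑ k, Q ε k (P k ⟨f, hf⟩)‖ ≤ ε * ∑ k, ‖Q ε k (P k ⟨f, hf⟩)‖ := by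
          gcongr; exact norm_sum_le _ _
      _ = ∑ k, √ε * (√ε * ‖Q ε k (P k ⟨f, hf⟩)‖) := by
          rw [Finset.mul_sum]
          refine Finset.sum_congr rfl fun k _ => ?_
          rw [← mul_assoc, Real.mul_self_sqrt hε']
      _ ≤ ∑ k, √ε * ‖P k ⟨f, hf⟩‖ := by
          gcongr with k; exact (hT ε hε).norm_le' _ _

end IsLaplaceResolvent

/-- Let `L = ∑ j, G j P j + B` be symmetric on `W`, with bounded `B`, `G j` and `[P k, G j]`. If
`L u = v` and `L u' = v'` weakly, then `⟪v, u'⟫ = ⟪u, v'⟫`; that is, the adjoint of `L` is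
symmetric. -/
theorem inner_eq_of_weak_solutions [CompleteSpace H] {P : ι → W →ₗ[ℂ] H} {T : ℝ → H →ₗ[ℂ] H}
    {Q : ℝ → ι → H →ₗ[ℂ] H} (hT : ∀ ε > 0, IsLaplaceResolvent P ε (T ε) (Q ε))
    {G : ι → H →L[ℂ] H} {C : ι → ι → H →L[ℂ] H} {B : H →L[ℂ] H} (hG : ∀ j, ∀ f ∈ W, G j f ∈ W)
    (hC : ∀ j k (f : W), P k ⟨G j f, hG j f f.2⟩ = G j (P k f) + C j k f)
    {L : W →ₗ[ℂ] H} (hL : ∀ f : W, L f = ∑ j, G j (P j f) + B f)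
    (hsymm : ∀ f g : W, ⟪L f, (g : H)⟫_ℂ = ⟪(f : H), L g⟫_ℂ)
    {u v u' v' : H} (hu : ∀ w : W, ⟪v, (w : H)⟫_ℂ = ⟪u, L w⟫_ℂ)
    (hu' : ∀ w : W, ⟪v', (w : H)⟫_ℂ = ⟪u', L w⟫_ℂ) : ⟪v, u'⟫_ℂ = ⟪u, v'⟫_ℂ := by
  have hW : Dense (W : Set H) := (hT 1 one_pos).dense
  have hmem : ∀ ε > 0, T ε u' ∈ W := fun ε hε => (hT ε hε).mem u'
  set M : ℝ := ∑ j, (2 * ∑ k, ‖C j k‖) + 2 * ‖B‖ with hM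
  have hM0 : 0 ≤ M := by positivity
  have hcomm : ∀ ε (hε : 0 < ε) (w : W),
      ‖T ε (L w) - L ⟨T ε w, (hT ε hε).mem w⟩‖ ≤ M * ‖(w : H)‖ := by
    intro ε hε w
    have h1 : T ε (L w) - L ⟨T ε w, (hT ε hε).mem w⟩ =
        ∑ j, (T ε (G j (P j w)) - G j (T ε (P j w))) + (T ε (B w) - B (T ε w)) := by
      rw [hL, hL, map_add, map_sum, Finset.sum_sub_distrib]
      simp only [(hT ε hε).apply_mem, (hT ε hε).comm]
      abel
    rw [h1, hM, add_mul, Finset.sum_mul]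
    refine (norm_add_le _ _).trans (add_le_add ((norm_sum_le _ _).trans ?_) ?_)
    · exact Finset.sum_le_sum fun j _ => (hT ε hε).norm_commutator_le hε.le (hG j) (hC j) j w
    · have h2 : ‖T ε (B w)‖ ≤ ‖B‖ * ‖(w : H)‖ := ((hT ε hε).norm_le _).trans (B.le_opNorm _)
      have h3 : ‖B (T ε w)‖ ≤ ‖B‖ * ‖(w : H)‖ := by
        refine (B.le_opNorm _).trans ?_
        gcongr
        exact (hT ε hε).norm_le _
      linarith [norm_sub_le (T ε (B w)) (B (T ε w))]
  classical
  -- The value for `ε ≤ 0` is irrelevant.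
  set y : ℝ → H := fun ε => if hε : 0 < ε then L ⟨T ε u', hmem ε hε⟩ else 0 with hy
  have hyε : ∀ ε (hε : 0 < ε), y ε = L ⟨T ε u', hmem ε hε⟩ := fun ε hε => dif_pos hε
  have hu'' : ∀ w : W, ⟪L w, u'⟫_ℂ = ⟪(w : H), v'⟫_ℂ := fun w => by
    rw [← inner_conj_symm, ← hu' w, inner_conj_symm]
  have hbound : ∀ ε > 0, ‖y ε‖ ≤ ‖v'‖ + M * ‖u'‖ := by
    intro ε hε
    refine norm_le_of_dense_of_norm_inner_le hW (by positivity) fun w hw => ?_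
    have h1 : ⟪w, y ε⟫_ℂ = ⟪T ε w, v'⟫_ℂ +
        ⟪T ε (L ⟨w, hw⟩) - L ⟨T ε w, (hT ε hε).mem w⟩, u'⟫_ℂ := by
      rw [hyε ε hε, ← hsymm ⟨w, hw⟩, inner_sub_left, hu'' ⟨T ε w, (hT ε hε).mem w⟩,
        (hT ε hε).symm (L ⟨w, hw⟩)]
      simp only [add_sub_cancel]
    rw [h1]
    have h2 : ‖⟪T ε w, v'⟫_ℂ‖ ≤ ‖w‖ * ‖v'‖ := by
      refine (norm_inner_le_norm _ _).trans ?_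
      gcongr
      exact (hT ε hε).norm_le _
    have h3 : ‖⟪T ε (L ⟨w, hw⟩) - L ⟨T ε w, (hT ε hε).mem w⟩, u'⟫_ℂ‖ ≤ M * ‖w‖ * ‖u'‖ := by
      refine (norm_inner_le_norm _ _).trans ?_
      gcongr
      exact hcomm ε hε ⟨w, hw⟩
    linarith [norm_add_le ⟪T ε w, v'⟫_ℂ ⟪T ε (L ⟨w, hw⟩) - L ⟨T ε w, (hT ε hε).mem w⟩, u'⟫_ℂ]
  have hTu := IsLaplaceResolvent.tendsto hT u'
  have hweak : Tendsto (fun ε => ⟪u, y ε⟫_ℂ) (𝓝[>] 0) (𝓝 ⟪u, v'⟫_ℂ) := by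
    refine tendsto_of_dense_of_norm_sub_le (A := fun ε x => ⟪x, y ε⟫_ℂ)
      (A₀ := fun x => ⟪x, v'⟫_ℂ) hW (‖v'‖ + M * ‖u'‖) ?_ (by fun_prop) ?_ u
    · filter_upwards [self_mem_nhdsWithin] with ε hε a b
      rw [← inner_sub_left, mul_comm]
      refine (norm_inner_le_norm _ _).trans ?_
      gcongr
      exact hbound ε hε
    · intro w hw
      rw [← hu'' ⟨w, hw⟩]
      refine (tendsto_const_nhds.inner hTu).congr' ?_
      filter_upwards [self_mem_nhdsWithin] with ε hε
      rw [hyε ε hε, ← hsymm ⟨w, hw⟩]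
  -- By the weak equation for `u`, also `⟪u, y ε⟫ = ⟪v, T ε u'⟫`, which tends to `⟪v, u'⟫`.
  refine tendsto_nhds_unique ((tendsto_const_nhds.inner hTu).congr' ?_) hweak
  filter_upwards [self_mem_nhdsWithin] with ε hε
  rw [hyε ε hε, ← hu ⟨T ε u', hmem ε hε⟩]

end Resolvent

/-! ### Real Fourier multipliers -/

namespace FirstOrder

variable {n N : ℕ}

/-- `g` is obtained from `f` by applying the real Fourier multiplier `m`. As a relation it also
covers unbounded `m`, where not every `f` has such a `g`. -/
def IsFourierMul (m : EuclideanSpace ℝ (Fin n) → ℝ) (f g : L2 n N) : Prop :=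
  (𝓕 g : L2 n N) =ᵐ[volume] fun ξ => m ξ • (𝓕 f : L2 n N) ξ

namespace IsFourierMul

variable {m m' : EuclideanSpace ℝ (Fin n) → ℝ} {f g h f' g' : L2 n N}

theorem unique (h₁ : IsFourierMul m f g) (h₂ : IsFourierMul m f h) : g = h := by
  have : (𝓕 g : L2 n N) = 𝓕 h := Lp.ext (h₁.trans h₂.symm)
  exact (Lp.fourierTransformₗᵢ _ _).injective this

theorem comp (h₁ : IsFourierMul m f g) (h₂ : IsFourierMul m' g h) :
    IsFourierMul (fun ξ => m' ξ * m ξ) f h := by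
  filter_upwards [h₁, h₂] with ξ e₁ e₂
  rw [e₂, e₁, mul_smul]

theorem factor (h₁ : IsFourierMul m f g) (h₂ : IsFourierMul (fun ξ => m' ξ * m ξ) f h) :
    IsFourierMul m' g h := by
  filter_upwards [h₁, h₂] with ξ e₁ e₂
  rw [e₂, e₁, mul_smul]

theorem congr (h₁ : IsFourierMul m f g) (hm : ∀ ξ, m ξ = m' ξ) : IsFourierMul m' f g := by
  rwa [← funext hm]

theorem one (f : L2 n N) : IsFourierMul (fun _ => 1) f f :=
  .of_forall fun ξ => by simp

theorem add_mul (h₁ : IsFourierMul m f g) (h₂ : IsFourierMul m' f h) :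
    IsFourierMul (fun ξ => m ξ + m' ξ) f (g + h) := by
  unfold IsFourierMul at *
  rw [FourierTransform.fourier_add]
  filter_upwards [h₁, h₂, Lp.coeFn_add (𝓕 g : L2 n N) (𝓕 h)] with ξ e₁ e₂ e₃
  rw [e₃, Pi.add_apply, e₁, e₂, add_smul]

theorem smul_mul (c : ℝ) (h₁ : IsFourierMul m f g) :
    IsFourierMul (fun ξ => c * m ξ) f ((c : ℂ) • g) := by
  unfold IsFourierMul at *
  rw [FourierTransform.fourier_smul]
  filter_upwards [h₁, Lp.coeFn_smul (c : ℂ) (𝓕 g : L2 n N)] with ξ e₁ e₂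
  rw [e₂, Pi.smul_apply, e₁, mul_smul, Complex.coe_smul]

theorem sum_mul {ι : Type*} (s : Finset ι) {m : ι → EuclideanSpace ℝ (Fin n) → ℝ}
    {g : ι → L2 n N} (h : ∀ k, IsFourierMul (m k) f (g k)) :
    IsFourierMul (fun ξ => ∑ k ∈ s, m k ξ) f (∑ k ∈ s, g k) := by
  classical
  induction s using Finset.induction_on with
  | empty =>
    have : (𝓕 (0 : L2 n N) : L2 n N) = 0 := (Lp.fourierTransformₗᵢ _ _).map_zero
    unfold IsFourierMul
    simp only [Finset.sum_empty, zero_smul, this]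
    exact Lp.coeFn_zero _ _ _
  | insert a s ha ih =>
    simp only [Finset.sum_insert ha]
    exact (h a).add_mul ih

theorem inner_left_eq (h₁ : IsFourierMul m f g) (h₂ : IsFourierMul m f' g') :
    ⟪g, f'⟫_ℂ = ⟪f, g'⟫_ℂ := by
  rw [← Lp.inner_fourier_eq g, ← Lp.inner_fourier_eq f, L2.inner_def, L2.inner_def]
  refine integral_congr_ae ?_
  filter_upwards [h₁, h₂] with ξ e₁ e₂
  rw [e₁, e₂, inner_smul_left_eq_star_smul, inner_smul_right_eq_smul, starRingEnd_apply,
    star_trivial]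

theorem norm_le (h₁ : IsFourierMul m f g) {c : ℝ} (hm : ∀ ξ, |m ξ| ≤ c) : ‖g‖ ≤ c * ‖f‖ := by
  rw [← Lp.norm_fourier_eq g, ← Lp.norm_fourier_eq f]
  refine Lp.norm_le_mul_norm_of_ae_le_mul ?_
  filter_upwards [h₁] with ξ e₁
  rw [e₁, norm_smul, Real.norm_eq_abs]
  exact mul_le_mul_of_nonneg_right (hm ξ) (norm_nonneg _)

end IsFourierMul

theorem exists_fourierMul {m : EuclideanSpace ℝ (Fin n) → ℝ} (hm : Continuous m) {c : ℝ}
    (hc : ∀ ξ, |m ξ| ≤ c) :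
    ∃ M : L2 n N →ₗ[ℂ] L2 n N, ∀ f, IsFourierMul m f (M f) := by
  have hmem : MemLp (fun ξ => (m ξ : ℂ)) ∞ (volume : Measure (EuclideanSpace ℝ (Fin n))) := by
    refine memLp_top_of_bound (Complex.continuous_ofReal.comp hm).aestronglyMeasurable c
      (.of_forall fun ξ => ?_)
    rw [Complex.norm_real]
    exact hc ξ
  let A : L2 n N →ₗ[ℂ] L2 n N :=
    { toFun := fun f => hmem.toLp _ • f
      map_add' := fun f g => Lp.add_smul _ _ _
      map_smul' := fun a f => (Lp.smul_comm _ _ _).symm }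
  let Φ := Lp.fourierTransformₗᵢ (EuclideanSpace ℝ (Fin n)) (EuclideanSpace ℂ (Fin N))
  refine ⟨Φ.symm.toLinearMap ∘ₗ A ∘ₗ Φ.toLinearMap, fun f => ?_⟩
  have h1 : (𝓕 ((Φ.symm.toLinearMap ∘ₗ A ∘ₗ Φ.toLinearMap) f) : L2 n N) =
      hmem.toLp _ • (𝓕 f : L2 n N) := Φ.apply_symm_apply _
  unfold IsFourierMul
  rw [h1]
  filter_upwards [Lp.coeFn_lpSMul (r := 2) (hmem.toLp _) (𝓕 f : L2 n N), hmem.coeFn_toLp]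
    with ξ e₁ e₂
  rw [e₁, Pi.smul_apply', e₂, Complex.coe_smul]

/-- Weak differentiation is multiplication by `2πi ξ_j` on the Fourier side. -/
theorem isWeakDeriv_iff_fourier {j : Fin n} {f g : L2 n N} :
    IsWeakDeriv j f g ↔ (𝓕 g : L2 n N) =ᵐ[volume]
      fun ξ => (2 * Real.pi * Complex.I) • (ξ j : ℂ) • (𝓕 f : L2 n N) ξ := by
  have hξ : ∀ ξ : EuclideanSpace ℝ (Fin n),
      ((inner ℝ ξ (EuclideanSpace.single j (1 : ℝ)) : ℝ) : ℂ) = ξ j := fun ξ => by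
    simp [EuclideanSpace.inner_single_right]
  have htg : (fun ξ : EuclideanSpace ℝ (Fin n) =>
      inner ℝ ξ (EuclideanSpace.single j (1 : ℝ))).HasTemperateGrowth := by fun_prop
  have hF : IsWeakDeriv j f g ↔
      ∀ u : 𝓢(EuclideanSpace ℝ (Fin n), ℂ),
        ∫ ξ, u ξ • ((2 * Real.pi * Complex.I) • (ξ j : ℂ) • (𝓕 f : L2 n N) ξ) =
          ∫ ξ, u ξ • (𝓕 g : L2 n N) ξ := by
    unfold IsWeakDeriv
    rw [← (FourierTransform.fourierEquiv ℂ 𝓢'(EuclideanSpace ℝ (Fin n),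
      EuclideanSpace ℂ (Fin N))).injective.eq_iff]
    simp only [FourierTransform.fourierEquiv_apply]
    rw [TemperedDistribution.fourier_lineDerivOp_eq, Lp.fourier_toTemperedDistribution_eq,
      Lp.fourier_toTemperedDistribution_eq, DFunLike.ext_iff]
    refine forall_congr' fun u => ?_
    have h1 : ∀ ξ, SchwartzMap.smulLeftCLM ℂ (fun ξ : EuclideanSpace ℝ (Fin n) =>
        ((inner ℝ ξ (EuclideanSpace.single j (1 : ℝ)) : ℝ) : ℂ)) u ξ = (ξ j : ℂ) • u ξ := by
      intro ξ
      rw [SchwartzMap.smulLeftCLM_apply_apply (by fun_prop), hξ]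
    simp only [smul_apply, TemperedDistribution.smulLeftCLM_apply_apply,
      Lp.toTemperedDistribution_apply, h1, ← integral_smul]
    refine Eq.congr (integral_congr_ae (.of_forall fun ξ => ?_)) rfl
    simp only [smul_smul]
    congr 1
    simp only [smul_eq_mul]
    ring
  rw [hF]
  constructor
  · intro h
    set d : EuclideanSpace ℝ (Fin n) → EuclideanSpace ℂ (Fin N) :=
      fun ξ => (2 * Real.pi * Complex.I) • (ξ j : ℂ) • (𝓕 f : L2 n N) ξ with hd
    have hl : ∀ k : L2 n N, LocallyIntegrable k := fun k =>
      (Lp.memLp k).locallyIntegrable one_le_two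
    have hdl : LocallyIntegrable d := by
      refine LocallyIntegrable.smul (c := (2 * Real.pi * Complex.I)) ?_
      rw [← locallyIntegrableOn_univ]
      refine (locallyIntegrableOn_univ.2 (hl _)).continuousOn_smul isOpen_univ.isLocallyClosed ?_
      fun_prop
    refine ae_eq_of_integral_contDiff_smul_eq (hl _) hdl fun u hu hc => ?_
    have hc' : HasCompactSupport (Complex.ofRealCLM ∘ u) := hc.comp_left rfl
    have hu' : ContDiff ℝ ∞ (Complex.ofRealCLM ∘ u) := by fun_prop
    simpa [hd] using (h (hc'.toSchwartzMap hu')).symm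
  · intro h u
    refine integral_congr_ae ?_
    filter_upwards [h] with ξ e
    rw [e]

/-! ### The momentum operators and their resolvents -/

theorem isWeakDeriv_iff_isFourierMul {j : Fin n} {f g : L2 n N} :
    IsWeakDeriv j f g ↔ IsFourierMul (fun ξ => 2 * Real.pi * ξ j) f (-Complex.I • g) := by
  have h : ((𝓕 (-Complex.I • g) : L2 n N) : EuclideanSpace ℝ (Fin n) → _) =ᵐ[volume]
      fun ξ => -Complex.I • (𝓕 g : L2 n N) ξ := by
    rw [FourierTransform.fourier_smul]
    exact Lp.coeFn_smul _ _
  rw [isWeakDeriv_iff_fourier]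
  unfold IsFourierMul
  constructor
  · intro hg
    filter_upwards [h, hg] with ξ e₁ e₂
    rw [e₁, e₂, ← Complex.coe_smul, smul_smul, smul_smul]
    congr 1
    push_cast
    linear_combination (-2 * (Real.pi : ℂ) * ξ j) * Complex.I_mul_I
  · intro hg
    filter_upwards [h, hg] with ξ e₁ e₂
    rw [e₁] at e₂
    have e₃ := congrArg (fun z => Complex.I • z) e₂
    simp only [smul_smul, ← Complex.coe_smul] at e₃ ⊢
    rw [mul_neg, Complex.I_mul_I, neg_neg, one_smul] at e₃
    rw [e₃]
    congr 1
    push_cast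
    ring

theorem mem_domain_grad_iff {f : L2 n N} : f ∈ (grad n N).domain ↔
    ∀ k, ∃ g, IsFourierMul (fun ξ => 2 * Real.pi * ξ k) f g := by
  rw [LinearPMap.mem_domain_iff, graph_grad]
  constructor
  · rintro ⟨y, hy⟩ k
    exact ⟨_, isWeakDeriv_iff_isFourierMul.1 (hy k)⟩
  · intro h
    choose g hg using h
    refine ⟨WithLp.toLp 2 fun k => Complex.I • g k, fun k => ?_⟩
    rw [isWeakDeriv_iff_isFourierMul]
    simpa [smul_smul] using hg k

/-- The momentum operator `P_k = -i ∂_k` on the Sobolev space `W^{1,2}(ℝⁿ)^N`. -/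
noncomputable def momentum (n N : ℕ) (k : Fin n) : (grad n N).domain →ₗ[ℂ] L2 n N :=
  -Complex.I • partialD N k

theorem momentum_apply (k : Fin n) (f : (grad n N).domain) :
    momentum n N k f = -Complex.I • partialD N k f := rfl

theorem isFourierMul_momentum (k : Fin n) (f : (grad n N).domain) :
    IsFourierMul (fun ξ => 2 * Real.pi * ξ k) (f : L2 n N) (momentum n N k f) := by
  have h : ((f : L2 n N), grad n N f) ∈ gradGraph n N := by
    rw [← graph_grad]
    exact (grad n N).mem_graph f
  exact isWeakDeriv_iff_isFourierMul.1 (h k)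

theorem momentum_symm (k : Fin n) (f g : (grad n N).domain) :
    ⟪momentum n N k f, (g : L2 n N)⟫_ℂ = ⟪(f : L2 n N), momentum n N k g⟫_ℂ :=
  (isFourierMul_momentum k f).inner_left_eq (isFourierMul_momentum k g)

/-- The resolvent of the Laplacian is the Fourier multiplier `(1 + ε ∑ k, (2π ξ_k)²)⁻¹`. -/
theorem exists_isLaplaceResolvent (n N : ℕ) {ε : ℝ} (hε : 0 < ε) :
    ∃ T Q, IsLaplaceResolvent (momentum n N) ε T Q := by
  set p : Fin n → EuclideanSpace ℝ (Fin n) → ℝ := fun k ξ => 2 * Real.pi * ξ k with hp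
  set s : EuclideanSpace ℝ (Fin n) → ℝ := fun ξ => 1 + ε * ∑ k, p k ξ ^ 2 with hs
  have hs1 : ∀ ξ, 1 ≤ s ξ := fun ξ => by
    have : 0 ≤ ε * ∑ k, p k ξ ^ 2 := by positivity
    simp only [hs]
    linarith
  have hs0 : ∀ ξ, 0 < s ξ := fun ξ => one_pos.trans_le (hs1 ξ)
  have hsp : ∀ k ξ, ε * p k ξ ^ 2 ≤ s ξ - 1 := fun k ξ => by
    have : p k ξ ^ 2 ≤ ∑ k, p k ξ ^ 2 :=
      Finset.single_le_sum (f := fun k => p k ξ ^ 2) (fun _ _ => sq_nonneg _) (Finset.mem_univ k)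
    simp only [hs, add_sub_cancel_left]
    gcongr
  have hpc : ∀ k, Continuous (p k) := fun k => by simp only [hp]; fun_prop
  have hsc : Continuous fun ξ => (s ξ)⁻¹ :=
    Continuous.inv₀ (by simp only [hs]; fun_prop) fun ξ => (hs0 ξ).ne'
  have hb : ∀ ξ, |(s ξ)⁻¹| ≤ 1 := fun ξ => by
    rw [abs_inv, abs_of_pos (hs0 ξ)]
    exact inv_le_one_of_one_le₀ (hs1 ξ)
  have hb' : ∀ k ξ, |p k ξ * (s ξ)⁻¹| ≤ (√ε)⁻¹ := fun k ξ => by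
    rw [abs_mul, abs_inv, abs_of_pos (hs0 ξ), ← div_eq_mul_inv, div_le_iff₀ (hs0 ξ),
      inv_mul_eq_div, le_div_iff₀ (Real.sqrt_pos.2 hε)]
    have h1 := hsp k ξ
    have h2 : (|p k ξ| * √ε) ^ 2 = ε * p k ξ ^ 2 := by
      rw [mul_pow, sq_abs, Real.sq_sqrt hε.le, mul_comm]
    nlinarith [sq_nonneg (|p k ξ| * √ε - 1), hs1 ξ]
  have hb'' : ∀ j k ξ, |p k ξ * (s ξ)⁻¹ * p j ξ| ≤ ε⁻¹ := fun j k ξ => by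
    rw [mul_right_comm, abs_mul, abs_inv, abs_of_pos (hs0 ξ), ← div_eq_mul_inv,
      div_le_iff₀ (hs0 ξ), inv_mul_eq_div, le_div_iff₀ hε, abs_mul]
    have h1 := hsp k ξ
    have h2 := hsp j ξ
    have h3 : |p k ξ| * |p j ξ| ≤ (p k ξ ^ 2 + p j ξ ^ 2) / 2 := by
      nlinarith [sq_nonneg (|p k ξ| - |p j ξ|), sq_abs (p k ξ), sq_abs (p j ξ)]
    nlinarith
  obtain ⟨T, hT⟩ := exists_fourierMul (N := N) hsc hb
  have hQ' : ∀ k, ∃ M : L2 n N →ₗ[ℂ] L2 n N,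
      ∀ f, IsFourierMul (fun ξ => p k ξ * (s ξ)⁻¹) f (M f) := fun k =>
    exists_fourierMul ((hpc k).mul hsc) (hb' k)
  choose Q hQ using hQ'
  have hmem : ∀ h, T h ∈ (grad n N).domain := fun h =>
    mem_domain_grad_iff.2 fun k => ⟨Q k h, (hT h).factor (hQ k h)⟩
  have hmem' : ∀ k h, Q k h ∈ (grad n N).domain := fun k h => by
    refine mem_domain_grad_iff.2 fun j => ?_
    have hb3 : ∀ ξ, |p j ξ * (p k ξ * (s ξ)⁻¹)| ≤ ε⁻¹ := fun ξ => by
      rw [mul_comm]; exact hb'' j k ξ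
    obtain ⟨S, hS⟩ := exists_fourierMul (N := N) ((hpc j).mul ((hpc k).mul hsc)) hb3
    exact ⟨S h, (hQ k h).factor (hS h)⟩
  refine ⟨T, Q, ⟨hmem, fun k h => ?_, hmem', fun h => ?_, fun k f => ?_, fun f g => ?_,
    fun h => ?_, fun k h => ?_, fun j k f => ?_⟩⟩
  · exact ((hT h).comp (isFourierMul_momentum k ⟨T h, hmem h⟩)).unique (hQ k h)
  · have h1 := IsFourierMul.sum_mul Finset.univ fun k =>
      (hQ k h).comp (isFourierMul_momentum k ⟨Q k h, hmem' k h⟩)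
    refine (((hT h).add_mul (h1.smul_mul ε)).congr fun ξ => ?_).unique (IsFourierMul.one h)
    have h2 : ∑ k, 2 * Real.pi * ξ k * (p k ξ * (s ξ)⁻¹) = (∑ k, p k ξ ^ 2) * (s ξ)⁻¹ := by
      rw [Finset.sum_mul]
      refine Finset.sum_congr rfl fun k _ => ?_
      simp only [hp]
      ring
    rw [h2, ← mul_inv_cancel₀ (hs0 ξ).ne']
    simp only [hs]
    ring
  · refine ((isFourierMul_momentum k f).comp (hT _)).unique ((hQ k f).congr fun ξ => ?_)
    simp only [hp]
    ring
  · exact (hT f).inner_left_eq (hT g)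
  · simpa using (hT h).norm_le hb
  · have := (hQ k h).norm_le (hb' k)
    rwa [inv_mul_eq_div, le_div_iff₀ (Real.sqrt_pos.2 hε), mul_comm] at this
  · have := ((isFourierMul_momentum j f).comp (hQ k _)).norm_le (hb'' j k)
    rwa [inv_mul_eq_div, le_div_iff₀ hε, mul_comm] at this

/-! ### From a core to the whole Sobolev space -/

theorem isClosed_grad (n N : ℕ) : (grad n N).IsClosed := by
  have : (gradGraph n N : Set (L2 n N × PiLp 2 fun _ : Fin n => L2 n N)) =
      ⋂ j, {p | IsWeakDeriv j p.1 (p.2 j)} := by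
    ext p
    simp only [Set.mem_iInter]
    rfl
  rw [LinearPMap.IsClosed, graph_grad, this]
  refine isClosed_iInter fun j => ?_
  refine isClosed_eq ?_ ?_
  · exact (LineDeriv.lineDerivOpCLM ℂ 𝓢'(EuclideanSpace ℝ (Fin n), EuclideanSpace ℂ (Fin N))
      (EuclideanSpace.single j (1 : ℝ)) ∘L Lp.toTemperedDistributionCLM _ volume 2).continuous.comp
      continuous_fst
  · exact (Lp.toTemperedDistributionCLM (EuclideanSpace ℂ (Fin N))
      (volume : Measure (EuclideanSpace ℝ (Fin n))) 2).continuous.comp (by fun_prop)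

/-- A closed condition on `(f, (P_k f)_k)` that holds on a core for the gradient holds on its whole
domain. -/
theorem grad_core_induction {D : Submodule ℂ (L2 n N)} (hD : (grad n N).HasCore D)
    {p : L2 n N → (Fin n → L2 n N) → Prop}
    (hp : IsClosed {q : L2 n N × (Fin n → L2 n N) | p q.1 q.2})
    (h : ∀ f : D, p f fun k => momentum n N k ⟨f, hD.le_domain f.2⟩) (f : (grad n N).domain) :
    p f fun k => momentum n N k f := by
  have hle : (grad n N).domRestrict D ≤ grad n N := LinearPMap.domRestrict_le
  have hc := (isClosed_grad n N).isClosable.leIsClosable hle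
  let Z : Set (L2 n N × PiLp 2 fun _ : Fin n => L2 n N) :=
    {q | p q.1 fun k => -Complex.I • q.2 k}
  have hZ : IsClosed Z := by
    refine hp.preimage (f := fun q : L2 n N × PiLp 2 (fun _ : Fin n => L2 n N) =>
      (q.1, fun k => -Complex.I • q.2 k)) ?_
    fun_prop
  have hsub : (((grad n N).domRestrict D).graph : Set _) ⊆ Z := by
    rintro ⟨a, b⟩ hab
    obtain ⟨x, rfl, rfl⟩ := (LinearPMap.mem_graph_iff _).1 hab
    have hx : (x : L2 n N) ∈ D := x.2.1
    have := h ⟨x, hx⟩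
    rwa [show (grad n N).domRestrict D x = grad n N ⟨x, hD.le_domain hx⟩ from hle.2 rfl]
  have hmem : ((f : L2 n N), grad n N f) ∈ ((grad n N).domRestrict D).graph.topologicalClosure := by
    rw [hc.graph_closure_eq_closure_graph, hD.closure_eq]
    exact (grad n N).mem_graph f
  exact (hZ.closure_subset_iff.2 hsub) hmem

/-- A bounded operator that preserves a core and has bounded commutators with the `P_k` there
preserves the Sobolev space, with the same commutators. -/
theorem exists_mem_domain_momentum_eq {D : Submodule ℂ (L2 n N)} (hD : (grad n N).HasCore D)
    {F : L2 n N →L[ℂ] L2 n N} {C : Fin n → L2 n N →L[ℂ] L2 n N} (hF : ∀ f ∈ D, F f ∈ D)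
    (hC : ∀ k (f : D), partialComm k F hD.le_domain hF f = C k f) (f : (grad n N).domain) :
    ∃ h : F f ∈ (grad n N).domain, ∀ k, momentum n N k ⟨F f, h⟩ = F (momentum n N k f) + C k f := by
  let p : L2 n N → (Fin n → L2 n N) → Prop := fun f g =>
    (F f, WithLp.toLp 2 fun k => Complex.I • (F (g k) + C k f)) ∈ (grad n N).graph
  have hp : IsClosed {q : L2 n N × (Fin n → L2 n N) | p q.1 q.2} := by
    refine IsClosed.preimage (f := fun q : L2 n N × (Fin n → L2 n N) =>
      (F q.1, (WithLp.toLp 2 fun k => Complex.I • (F (q.2 k) + C k q.1) :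
        PiLp 2 fun _ : Fin n => L2 n N))) ?_ (isClosed_grad n N)
    fun_prop
  have key : p f fun k => momentum n N k f := by
    refine grad_core_induction hD hp (fun f => ?_) f
    refine (LinearPMap.mem_graph_iff _).2 ⟨⟨F f, hD.le_domain (hF f f.2)⟩, rfl, ?_⟩
    ext1 k
    have h1 := hC k f
    simp only [partialComm, ← momentum_apply] at h1
    simp only [← h1, add_sub_cancel]
    rw [momentum_apply, smul_smul, mul_neg, Complex.I_mul_I, neg_neg, one_smul]
    rfl
  obtain ⟨⟨x, hx⟩, hx1, hx2⟩ := (LinearPMap.mem_graph_iff _).1 key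
  dsimp only at hx1
  subst hx1
  refine ⟨hx, fun k => ?_⟩
  have : partialD N k ⟨F f, hx⟩ = Complex.I • (F (momentum n N k f) + C k f) :=
    congrArg (fun y : PiLp 2 (fun _ : Fin n => L2 n N) => y k) hx2
  rw [momentum_apply, this, smul_smul, neg_mul, Complex.I_mul_I, neg_neg, one_smul]

end FirstOrder

/-! ### Essential self-adjointness -/

open FirstOrder in
theorem theorem2p4 {n N : ℕ}
    (F : Fin n → FirstOrder.L2 n N →L[ℂ] FirstOrder.L2 n N)
    (D : Submodule ℂ (FirstOrder.L2 n N))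
    (hD : (FirstOrder.grad n N).HasCore D)
    (hF : ∀ j, ∀ f ∈ D, F j f ∈ D)
    (hF' : ∀ j, ∀ f ∈ D, ContinuousLinearMap.adjoint (F j) f ∈ D)
    (hcomm : ∀ j k, ∃ d : FirstOrder.L2 n N →L[ℂ] FirstOrder.L2 n N,
      ∀ f : D, FirstOrder.partialComm k (F j) hD.le_domain (hF j) f = d f)
    (hcomm' : ∀ j k, ∃ d : FirstOrder.L2 n N →L[ℂ] FirstOrder.L2 n N,
      ∀ f : D, FirstOrder.partialComm k (ContinuousLinearMap.adjoint (F j)) hD.le_domain (hF' j) f =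
        d f) :
    FirstOrder.IsEssentiallySelfAdjoint (FirstOrder.firstOrderOp F D hD.le_domain hF') := by
  choose C hC using hcomm
  choose C' hC' using hcomm'
  have hFW := fun j f => exists_mem_domain_momentum_eq hD (hF j) (hC j) f
  have hFW' := fun j f => exists_mem_domain_momentum_eq hD (hF' j) (hC' j) f
  choose hm hP using hFW
  choose hm' hP' using hFW'
  set P := momentum n N with hPdef
  let G : Fin n → L2 n N →L[ℂ] L2 n N := fun j => F j + ContinuousLinearMap.adjoint (F j)
  let B : L2 n N →L[ℂ] L2 n N := ∑ j, C' j j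
  have hG : ∀ j, ∀ f ∈ (grad n N).domain, G j f ∈ (grad n N).domain := fun j f hf =>
    add_mem (hm j ⟨f, hf⟩) (hm' j ⟨f, hf⟩)
  have hGC : ∀ j k (f : (grad n N).domain),
      P k ⟨G j f, hG j f f.2⟩ = G j (P k f) + (C j k + C' j k) f := by
    intro j k f
    have h1 : P k ⟨G j f, hG j f f.2⟩ = P k ⟨F j f, hm j f⟩ +
        P k ⟨ContinuousLinearMap.adjoint (F j) f, hm' j f⟩ := by
      rw [← map_add]
      rfl
    rw [h1, hP, hP']
    simp only [G, add_apply]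
    abel
  let L : (grad n N).domain →ₗ[ℂ] L2 n N :=
    ∑ j, (G j).toLinearMap ∘ₗ P j + B.toLinearMap ∘ₗ (grad n N).domain.subtype
  have hL : ∀ f, L f = ∑ j, G j (P j f) + B f := fun f => by
    simp [L, LinearMap.sum_apply]
  have hL' : ∀ f, L f =
      ∑ j, (F j (P j f) + P j ⟨ContinuousLinearMap.adjoint (F j) f, hm' j f⟩) := fun f => by
    rw [hL]
    simp only [hP', B, G, sum_apply, add_apply, ← Finset.sum_add_distrib]
    refine Finset.sum_congr rfl fun j _ => ?_
    abel
  have hsymm : ∀ f g : (grad n N).domain, ⟪L f, (g : L2 n N)⟫_ℂ = ⟪(f : L2 n N), L g⟫_ℂ := by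
    intro f g
    rw [hL', hL', sum_inner, inner_sum]
    refine Finset.sum_congr rfl fun j _ => ?_
    rw [inner_add_left, inner_add_right, add_comm, hPdef,
      momentum_symm j ⟨_, hm' j f⟩ g, ← momentum_symm j f ⟨_, hm' j g⟩,
      ContinuousLinearMap.adjoint_inner_left, ContinuousLinearMap.adjoint_inner_right]
  -- `firstOrderOp F D` is the restriction of `L` to the core.
  set A := firstOrderOp F D hD.le_domain hF' with hA
  have hAL : ∀ f : D, A f = L ⟨f, hD.le_domain f.2⟩ := by
    intro f
    rw [hL', Finset.sum_add_distrib]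
    simp only [hPdef, momentum_apply, map_smul, ← Finset.smul_sum]
    rw [neg_smul Complex.I (∑ j, partialD N j _), ← sub_eq_add_neg]
    rfl
  -- The resolvents have to be chosen for all real `ε`; only `0 < ε` matters.
  have hT : ∀ ε : ℝ, ∃ T Q, 0 < ε → IsLaplaceResolvent P ε T Q := fun ε => by
    by_cases hε : 0 < ε
    · obtain ⟨T, Q, h⟩ := exists_isLaplaceResolvent n N hε
      exact ⟨T, Q, fun _ => h⟩
    · exact ⟨0, 0, fun h => absurd h hε⟩
  choose T Q hTQ using hT
  have hW : Dense ((grad n N).domain : Set (L2 n N)) := (hTQ 1 one_pos).dense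
  have hdense : Dense (A.domain : Set (L2 n N)) := by
    have hsub : ((grad n N).domain : Set (L2 n N)) ⊆ closure D := fun f hf =>
      grad_core_induction hD (p := fun f _ => f ∈ closure (D : Set (L2 n N)))
        (isClosed_closure.preimage continuous_fst) (fun f => subset_closure f.2) ⟨f, hf⟩
    exact dense_closure.1 (hW.mono hsub)
  have hAsymm : A.IsFormalAdjoint A := fun f g => by
    rw [hAL f, hAL g]
    exact hsymm ⟨f, hD.le_domain f.2⟩ ⟨g, hD.le_domain g.2⟩
  have hweak : ∀ (u : A†.domain) (w : (grad n N).domain),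
      ⟪A† u, (w : L2 n N)⟫_ℂ = ⟪(u : L2 n N), L w⟫_ℂ := by
    intro u w
    rw [hL]
    refine grad_core_induction hD
      (p := fun w g => ⟪A† u, w⟫_ℂ = ⟪(u : L2 n N), ∑ j, G j (g j) + B w⟫_ℂ)
      (isClosed_eq (by fun_prop) (by fun_prop)) (fun f => ?_) w
    rw [← hPdef, ← hL ⟨f, hD.le_domain f.2⟩, ← hAL]
    exact A.adjoint_isFormalAdjoint hdense u f
  exact ⟨hdense, hAsymm, LinearPMap.isSelfAdjoint_closure hdense hAsymm fun u u' =>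
    inner_eq_of_weak_solutions hTQ hG hGC hL hsymm (hweak u) (hweak u')⟩
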